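/- Let $M$ be a smooth $n$-dimensional manifold and let $f\colon M\to\mathbb R^{n+1}$ be a smooth immersion with a centroaffine normalization centred at $0$: a transversal vector field $\xi=c f$ with a constant $c\neq 0$, so that $\mathbb R^{n+1}=f_*(T_xM)\oplus\mathbb R\,\xi_x$ for all $x\in M$. Let $\nabla$ be the induced connection on $M$, given by the Gauss formula $D_X f_*Y=f_*\nabla_XY+g(X,Y)\,\xi$, where $D$ is the standard flat connection of $\mathbb R^{n+1}$. On every $2$-dimensional vector subspace $\pi\subset\mathbb R^{n+1}$ fix an arbitrary determinant $\det$, i.e. a nonzero alternating bilinear form. A curve in $\pi$ means here a smooth regular curve $\gamma\colon I\to M$ on a nonempty open interval $I$ with $f(\gamma(I))\subset\pi$. It is called maximal if it is not, up to a regular change of parameter, the restriction of another such curve $\sigma\colon J\to M$ in $\pi$ to a proper subinterval of $J$. Suppose that for every such plane $\pi$, every maximal curve in $\pi$ has a regular parametrization $\gamma\colon\mathbb R\to M$ on the whole of $\mathbb R$ (obtained from the given one by a smooth change of parameter) for which there is $\varepsilon>0$ with $|\det((f\circ\gamma)(t),(f\circ\gamma)'(t))|\ge\varepsilon$ for all $t\in\mathbb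 R$. Then $\nabla$ is complete: every $\nabla$-geodesic extends to a $\nabla$-geodesic whose affine parameter runs through all of $\mathbb R$. -/

import Mathlib

open scoped Manifold ContDiff

noncomputable section

namespace AffineHypersurface

/-! ### Geodesics and completeness of an affine connection -/

section Connection

variable {n : ℕ} {M : Type*} [TopologicalSpace M] [ChartedSpace (EuclideanSpace ℝ (Fin n)) M]

/-- The velocity `γ'(t)` of a curve in a manifold. -/
def velocity (n : ℕ) {M : Type*} [TopologicalSpace M] [ChartedSpace (EuclideanSpace ℝ (Fin n)) M]
    (γ : ℝ → M) (t : ℝ) : TangentSpace (𝓡 n) (γ t) :=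
  mfderiv 𝓘(ℝ, ℝ) (𝓡 n) γ t (1 : ℝ)

/-- The covariant derivative `(D/dt) V` at `t` of a vector field `V` along the curve `γ`, for the
connection `cov` (`cov Y x v` is `∇_v Y`). In the coordinate frame `E₁, …, Eₙ` around `γ(t)` write
`V(s) = ∑ aⁱ(s) Eᵢ(γ(s))`; the value is `∑ (aⁱ)'(t) Eᵢ + ∑ aⁱ(t) ∇_{γ'(t)} Eᵢ`. The first sum is
the first summand below; `FiberBundle.extend _ (V t)` is the local field `∑ aⁱ(t) Eᵢ` with
constant coefficients, so that the second sum is the second summand. -/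
def covariantDerivAlong [IsManifold (𝓡 n) ∞ M]
    (cov : CovariantDerivative (𝓡 n) (EuclideanSpace ℝ (Fin n))
      (TangentSpace (𝓡 n) : M → Type _))
    (γ : ℝ → M) (V : ∀ t, TangentSpace (𝓡 n) (γ t)) (t : ℝ) : TangentSpace (𝓡 n) (γ t) :=
  (trivializationAt (EuclideanSpace ℝ (Fin n)) (TangentSpace (𝓡 n) : M → Type _) (γ t)).symm (γ t)
      (deriv (fun s : ℝ =>
        (trivializationAt (EuclideanSpace ℝ (Fin n)) (TangentSpace (𝓡 n) : M → Type _) (γ t)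
          ⟨γ s, V s⟩).2) t)
    + cov (FiberBundle.extend (EuclideanSpace ℝ (Fin n)) (V t)) (γ t) (velocity n γ t)

/-- `γ` restricted to the nonempty open interval `I` is a geodesic with affine parameter:
it is smooth and `∇_{γ'} γ' = 0`. -/
structure IsGeodesicOn [IsManifold (𝓡 n) ∞ M]
    (cov : CovariantDerivative (𝓡 n) (EuclideanSpace ℝ (Fin n))
      (TangentSpace (𝓡 n) : M → Type _))
    (γ : ℝ → M) (I : Set ℝ) : Prop where
  isOpen : IsOpen I
  ordConnected : I.OrdConnected
  nonempty : I.Nonempty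
  smooth : ContMDiffOn 𝓘(ℝ, ℝ) (𝓡 n) ∞ γ I
  geodesic : ∀ t ∈ I, covariantDerivAlong cov γ (velocity n γ) t = 0

/-- A connection is complete if every geodesic extends to a geodesic whose affine parameter runs
through all of `ℝ`. -/
def IsCompleteConnection [IsManifold (𝓡 n) ∞ M]
    (cov : CovariantDerivative (𝓡 n) (EuclideanSpace ℝ (Fin n))
      (TangentSpace (𝓡 n) : M → Type _)) : Prop :=
  ∀ (γ : ℝ → M) (I : Set ℝ), IsGeodesicOn cov γ I →
    ∃ σ : ℝ → M, IsGeodesicOn cov σ Set.univ ∧ Set.EqOn σ γ I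

end Connection

/-! ### Hypersurfaces with a transversal field and their induced connection -/

section Hypersurface

variable {n : ℕ} {M : Type*} [TopologicalSpace M] [ChartedSpace (EuclideanSpace ℝ (Fin n)) M]

/-- `f : M → ℝⁿ⁺¹` is a smooth immersed hypersurface and `ξ` is a smooth transversal vector field
for it. -/
structure IsTransversalField (f ξ : M → EuclideanSpace ℝ (Fin (n + 1))) : Prop where
  smooth_immersion : ContMDiff (𝓡 n) 𝓘(ℝ, EuclideanSpace ℝ (Fin (n + 1))) ∞ f
  injective_mvfderiv : ∀ x, Function.Injective (mvfderiv (𝓡 n) f x)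
  smooth_field : ContMDiff (𝓡 n) 𝓘(ℝ, EuclideanSpace ℝ (Fin (n + 1))) ∞ ξ
  transversal : ∀ x, ∀ u : TangentSpace (𝓡 n) x, mvfderiv (𝓡 n) f x u ≠ ξ x

/-- The transversal field `ξ` is a centroaffine normalization of `f` with center `0`: it is a
nonzero constant multiple of the position vector. -/
def IsCentroaffineNormalization (f ξ : M → EuclideanSpace ℝ (Fin (n + 1))) : Prop :=
  IsTransversalField f ξ ∧ ∃ c : ℝ, c ≠ 0 ∧ ∀ x, ξ x = c • f x

/-- The map `(u, s) ↦ f_* u + s ξ_x` from `T_x M × ℝ` to `ℝⁿ⁺¹`. -/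
def splitMap (f ξ : M → EuclideanSpace ℝ (Fin (n + 1))) (x : M) :
    (TangentSpace (𝓡 n) x × ℝ) →ₗ[ℝ] EuclideanSpace ℝ (Fin (n + 1)) :=
  LinearMap.coprod (mvfderiv (𝓡 n) f x).toLinearMap (LinearMap.toSpanSingleton ℝ _ (ξ x))

theorem splitMap_bijective {f ξ : M → EuclideanSpace ℝ (Fin (n + 1))}
    (h : IsTransversalField f ξ) (x : M) : Function.Bijective (splitMap f ξ x) := by
  have hinj : Function.Injective (splitMap f ξ x) := by
    rw [injective_iff_map_eq_zero]
    rintro ⟨u, s⟩ hus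
    have hus' : mvfderiv (𝓡 n) f x u + s • ξ x = 0 := by simpa [splitMap] using hus
    have hs : s = 0 := by
      by_contra hs
      apply h.transversal x (-(s⁻¹ • u))
      have h1 : mvfderiv (𝓡 n) f x u = -(s • ξ x) := eq_neg_of_add_eq_zero_left hus'
      rw [map_neg, map_smul, h1, smul_neg, neg_neg, smul_smul, inv_mul_cancel₀ hs, one_smul]
    subst hs
    have hu : u = 0 := by
      apply h.injective_mvfderiv x
      simpa using hus'
    simp [hu]
  have : FiniteDimensional ℝ (TangentSpace (𝓡 n) x) :=
    inferInstanceAs (FiniteDimensional ℝ (EuclideanSpace ℝ (Fin n)))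
  have hd : Module.finrank ℝ (TangentSpace (𝓡 n) x × ℝ)
      = Module.finrank ℝ (EuclideanSpace ℝ (Fin (n + 1))) := by
    have : Module.finrank ℝ (TangentSpace (𝓡 n) x) = n := finrank_euclideanSpace_fin (𝕜 := ℝ)
    rw [Module.finrank_prod, this]
    simp
  exact ⟨hinj, (LinearMap.injective_iff_surjective_of_finrank_eq_finrank hd).1 hinj⟩

/-- The tangential component of a vector: the `u ∈ T_x M` with `w = f_* u + s ξ_x`. -/
def tangentialPart {f ξ : M → EuclideanSpace ℝ (Fin (n + 1))} (h : IsTransversalField f ξ)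
    (x : M) : EuclideanSpace ℝ (Fin (n + 1)) →L[ℝ] TangentSpace (𝓡 n) x :=
  LinearMap.toContinuousLinearMap
    ((LinearMap.fst ℝ (TangentSpace (𝓡 n) x) ℝ).comp
      (LinearEquiv.ofBijective (splitMap f ξ x) (splitMap_bijective h x)).symm.toLinearMap)

theorem tangentialPart_mvfderiv {f ξ : M → EuclideanSpace ℝ (Fin (n + 1))}
    (h : IsTransversalField f ξ) (x : M) (u : TangentSpace (𝓡 n) x) :
    tangentialPart h x (mvfderiv (𝓡 n) f x u) = u := by
  have h1 : splitMap f ξ x (u, 0) = mvfderiv (𝓡 n) f x u := by simp [splitMap]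
  have h2 : (LinearEquiv.ofBijective (splitMap f ξ x) (splitMap_bijective h x)).symm
      (mvfderiv (𝓡 n) f x u) = (u, 0) := by
    rw [LinearEquiv.symm_apply_eq]; exact h1.symm
  simp [tangentialPart, h2]

theorem mdifferentiableAt_pushforward [IsManifold (𝓡 n) ∞ M]
    {f : M → EuclideanSpace ℝ (Fin (n + 1))}
    (hf : ContMDiff (𝓡 n) 𝓘(ℝ, EuclideanSpace ℝ (Fin (n + 1))) ∞ f)
    {Y : ∀ x : M, TangentSpace (𝓡 n) x} {x : M}
    (hY : MDifferentiableAt (𝓡 n) (𝓡 n).tangent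
      (fun y => (⟨y, Y y⟩ : TangentBundle (𝓡 n) M)) x) :
    MDifferentiableAt (𝓡 n) 𝓘(ℝ, EuclideanSpace ℝ (Fin (n + 1)))
      (fun y => mvfderiv (𝓡 n) f y (Y y)) x := by
  have h1 : ContMDiff (𝓡 n).tangent 𝓘(ℝ, EuclideanSpace ℝ (Fin (n + 1))).tangent 1
      (tangentMap (𝓡 n) 𝓘(ℝ, EuclideanSpace ℝ (Fin (n + 1))) f) :=
    hf.contMDiff_tangentMap (by norm_cast)
  have h2 := MDifferentiableAt.comp (f := fun y => (⟨y, Y y⟩ : TangentBundle (𝓡 n) M)) x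
    ((h1.mdifferentiable one_ne_zero) ⟨x, Y x⟩) hY
  rw [mdifferentiableAt_totalSpace] at h2
  have h3 := h2.2
  simp only [tangentMap, Function.comp_def, trivializationAt_model_space_apply] at h3
  exact h3

/-- The connection induced on `M` by the transversal field `ξ`: `∇_v Y` is the tangential component
of `D_v (f_* Y)`, as in the Gauss formula `D_v (f_* Y) = f_* (∇_v Y) + g(v, Y) ξ`. -/
def inducedConnection [IsManifold (𝓡 n) ∞ M] {f ξ : M → EuclideanSpace ℝ (Fin (n + 1))}
    (h : IsTransversalField f ξ) :
    CovariantDerivative (𝓡 n) (EuclideanSpace ℝ (Fin n))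
      (TangentSpace (𝓡 n) : M → Type _) where
  toFun Y x := (tangentialPart h x).comp
    (mvfderiv (𝓡 n) (fun y => mvfderiv (𝓡 n) f y (Y y)) x)
  isCovariantDerivativeOnUniv :=
    { add := by
        intro Y Z x hY hZ _
        have hY' := mdifferentiableAt_pushforward h.smooth_immersion hY
        have hZ' := mdifferentiableAt_pushforward h.smooth_immersion hZ
        have e : (fun y => mvfderiv (𝓡 n) f y ((Y + Z) y))
            = (fun y => mvfderiv (𝓡 n) f y (Y y)) + fun y => mvfderiv (𝓡 n) f y (Z y) := by
          funext y; simp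
        rw [e, mvfderiv_add hY' hZ', ContinuousLinearMap.comp_add]
      leibniz := by
        intro Y g x hY hg _
        have hY' := mdifferentiableAt_pushforward h.smooth_immersion hY
        have e : (fun y => mvfderiv (𝓡 n) f y ((g • Y) y))
            = g • fun y => mvfderiv (𝓡 n) f y (Y y) := by
          funext y; simp
        rw [e, mvfderiv_smul hg hY']
        ext v
        simp [tangentialPart_mvfderiv] }

/-- The Gauss formula for the induced connection. -/
theorem gauss_formula [IsManifold (𝓡 n) ∞ M] {f ξ : M → EuclideanSpace ℝ (Fin (n + 1))}
    (h : IsTransversalField f ξ) (Y : ∀ x : M, TangentSpace (𝓡 n) x) (x : M)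
    (v : TangentSpace (𝓡 n) x) :
    ∃ s : ℝ, mvfderiv (𝓡 n) (fun y => mvfderiv (𝓡 n) f y (Y y)) x v
      = mvfderiv (𝓡 n) f x (inducedConnection h Y x v) + s • ξ x := by
  set w := mvfderiv (𝓡 n) (fun y => mvfderiv (𝓡 n) f y (Y y)) x v with hw
  set e := LinearEquiv.ofBijective (splitMap f ξ x) (splitMap_bijective h x)
  refine ⟨(e.symm w).2, ?_⟩
  have h1 : splitMap f ξ x (e.symm w) = w := e.apply_symm_apply w
  calc w = splitMap f ξ x (e.symm w) := h1.symm
    _ = _ := by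
      simp only [splitMap, LinearMap.coprod_apply]
      rfl

end Hypersurface

/-! ### Curves in planes through the origin -/

section PlaneCurve

variable {n : ℕ} {M : Type*} [TopologicalSpace M] [ChartedSpace (EuclideanSpace ℝ (Fin n)) M]

/-- `γ` restricted to the nonempty open interval `I` is a smooth regular curve in `M` whose image
under `f` lies in the plane `π`. -/
structure IsCurveInPlane (f : M → EuclideanSpace ℝ (Fin (n + 1)))
    (π : Submodule ℝ (EuclideanSpace ℝ (Fin (n + 1)))) (γ : ℝ → M) (I : Set ℝ) : Prop where
  isOpen : IsOpen I
  ordConnected : I.OrdConnected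
  nonempty : I.Nonempty
  smooth : ContMDiffOn 𝓘(ℝ, ℝ) (𝓡 n) ∞ γ I
  regular : ∀ t ∈ I, velocity n γ t ≠ 0
  mem_plane : ∀ t ∈ I, f (γ t) ∈ π

/-- `φ` is a regular change of parameter from the interval `I` onto the interval `J`. -/
structure IsParameterChange (φ : ℝ → ℝ) (I J : Set ℝ) : Prop where
  smooth : ContDiffOn ℝ ∞ φ I
  deriv_ne_zero : ∀ t ∈ I, deriv φ t ≠ 0
  image_eq : φ '' I = J

/-- The curve `γ : I → M` in the plane `π` is maximal: whenever it is, up to a change of parameter,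
the restriction of a curve `σ : J → M` in `π` to a subinterval `J' ⊆ J`, then `J' = J`. -/
structure IsMaximalCurveInPlane (f : M → EuclideanSpace ℝ (Fin (n + 1)))
    (π : Submodule ℝ (EuclideanSpace ℝ (Fin (n + 1)))) (γ : ℝ → M) (I : Set ℝ) : Prop where
  isCurveInPlane : IsCurveInPlane f π γ I
  maximal : ∀ (σ : ℝ → M) (J J' : Set ℝ) (φ : ℝ → ℝ), IsCurveInPlane f π σ J →
    J' ⊆ J → IsParameterChange φ I J' → (∀ t ∈ I, γ t = σ (φ t)) → J' = J

/-- The curve `γ : I → M` has a parametrization `γ ∘ φ` on all of `ℝ` such that, with `r = f ∘ γ ∘ φ`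
viewed as a curve in the plane `π`, the function `det (r, r')` is bounded away from zero. -/
def HasGlobalParametrization (f : M → EuclideanSpace ℝ (Fin (n + 1)))
    (π : Submodule ℝ (EuclideanSpace ℝ (Fin (n + 1)))) (det : π [⋀^Fin 2]→ₗ[ℝ] ℝ)
    (γ : ℝ → M) (I : Set ℝ) : Prop :=
  ∃ φ : ℝ → ℝ, IsParameterChange φ Set.univ I ∧
    ∃ r : ℝ → π, (∀ t, (r t : EuclideanSpace ℝ (Fin (n + 1))) = f (γ (φ t))) ∧
      ∃ c : ℝ, 0 < c ∧ ∀ t, c ≤ |det ![r t, deriv r t]|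

end PlaneCurve

end AffineHypersurface

end

/-!
Since `ξ = c f`, the Gauss formula turns the geodesic equation into `(f ∘ γ)'' ∥ f ∘ γ`: geodesics
are the motions in a central force field. Hence a nonconstant geodesic stays in a plane through the
origin and sweeps out area at a constant rate (Kepler's second law). Conversely, a regular curve in
such a plane becomes a geodesic when it is parametrized by the area it sweeps out, which is
possible because transversality keeps `f ∘ γ` and `(f ∘ γ)'` linearly independent. So a maximal
geodesic is a maximal plane curve: a longer plane curve, parametrized by area, would be a longer
geodesic. In a parametrization `γ ∘ φ` over `ℝ` with `|det (r, r')| ≥ c`, the constancy of the areal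
velocity of `γ` bounds `|φ'|` away from zero, so the affine parameter `φ` takes all real values.
-/

noncomputable section

namespace AffineHypersurface

section Calculus

open Filter Topology

variable {V : Type*} [NormedAddCommGroup V] [NormedSpace ℝ V]

theorem hasDerivAt_of_contDiffOn {r : ℝ → V} {I : Set ℝ} (hI : IsOpen I)
    (hr : ContDiffOn ℝ ∞ r I) {t : ℝ} (ht : t ∈ I) : HasDerivAt r (deriv r t) t :=
  ((hr.contDiffAt (hI.mem_nhds ht)).differentiableAt (by simp)).hasDerivAt

theorem contDiffOn_deriv {r : ℝ → V} {I : Set ℝ} (hI : IsOpen I)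
    (hr : ContDiffOn ℝ ∞ r I) : ContDiffOn ℝ ∞ (deriv r) I :=
  hr.deriv_of_isOpen hI (by simp)

theorem eq_of_hasDerivAt_zero {g : ℝ → V} {I : Set ℝ} (hI : IsOpen I) (hI' : I.OrdConnected)
    (hg : ∀ t ∈ I, HasDerivAt g 0 t) {t u : ℝ} (ht : t ∈ I) (hu : u ∈ I) : g t = g u :=
  hI.is_const_of_deriv_eq_zero hI'.isPreconnected
    (fun x hx => (hg x hx).differentiableAt.differentiableWithinAt)
    (fun x hx => (hg x hx).deriv) ht hu

theorem surjective_of_le_deriv {φ : ℝ → ℝ} (hφ : Differentiable ℝ φ) {δ : ℝ} (hδ : 0 < δ)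
    (h : ∀ t, δ ≤ deriv φ t) : Function.Surjective φ := by
  have hgrowth {s t : ℝ} (hst : s ≤ t) : δ * (t - s) ≤ φ t - φ s :=
    mul_sub_le_image_sub_of_le_deriv hφ h hst
  have htop : Tendsto (fun t => δ * t + φ 0) atTop atTop :=
    tendsto_atTop_add_const_right _ _ (tendsto_id.const_mul_atTop hδ)
  have hbot : Tendsto (fun t => δ * t + φ 0) atBot atBot :=
    tendsto_atBot_add_const_right _ _ (tendsto_id.const_mul_atBot hδ)
  refine hφ.continuous.surjective (tendsto_atTop_mono' _ ?_ htop) (tendsto_atBot_mono' _ ?_ hbot)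
  · filter_upwards [eventually_ge_atTop 0] with t ht
    linarith [hgrowth ht]
  · filter_upwards [eventually_le_atBot 0] with t ht
    linarith [hgrowth ht]

theorem surjective_of_le_abs_deriv {φ : ℝ → ℝ} (hφ : Differentiable ℝ φ) {δ : ℝ} (hδ : 0 < δ)
    (h : ∀ t, δ ≤ |deriv φ t|) : Function.Surjective φ := by
  have hne : ∀ t ∈ Set.univ, deriv φ t ≠ 0 := fun t _ => abs_pos.1 (hδ.trans_le (h t))
  rcases hasDerivWithinAt_forall_lt_or_forall_gt_of_forall_ne convex_univ
    (fun t _ => (hφ t).hasDerivAt.hasDerivWithinAt) hne with hneg | hpos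
  · have hsurj : Function.Surjective (-φ) := surjective_of_le_deriv hφ.neg hδ fun t => by
      rw [deriv.neg, ← abs_of_neg (hneg t trivial)]
      exact h t
    intro y
    obtain ⟨t, ht⟩ := hsurj (-y)
    exact ⟨t, neg_injective ht⟩
  · exact surjective_of_le_deriv hφ hδ fun t => by
      rw [← abs_of_pos (hpos t trivial)]
      exact h t

end Calculus

section Geodesics

open Filter Topology

variable {n : ℕ} {M : Type*} [TopologicalSpace M] [ChartedSpace (EuclideanSpace ℝ (Fin n)) M]

theorem velocity_const (x : M) (t : ℝ) : velocity n (fun _ => x) t = 0 := by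
  rw [velocity, mfderiv_const]
  rfl

theorem eventuallyEq_velocity_lift {γ σ : ℝ → M} {t : ℝ} (h : γ =ᶠ[𝓝 t] σ) :
    (fun s => (⟨γ s, velocity n γ s⟩ : TangentBundle (𝓡 n) M)) =ᶠ[𝓝 t]
      fun s => ⟨σ s, velocity n σ s⟩ := by
  filter_upwards [eventually_eventually_nhds.2 h] with s (hs : γ =ᶠ[𝓝 s] σ)
  ext
  · exact hs.eq_of_nhds
  · exact heq_of_eq (DFunLike.congr_fun hs.mfderiv_eq (1 : ℝ))

variable [IsManifold (𝓡 n) ∞ M]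
  {cov : CovariantDerivative (𝓡 n) (EuclideanSpace ℝ (Fin n)) (TangentSpace (𝓡 n) : M → Type _)}

theorem isGeodesicOn_const (x : M) : IsGeodesicOn cov (fun _ => x) Set.univ where
  isOpen := isOpen_univ
  ordConnected := Set.ordConnected_univ
  nonempty := Set.univ_nonempty
  smooth := contMDiffOn_const
  geodesic t _ := by
    simp only [covariantDerivAlong, velocity_const, deriv_const, map_zero, add_zero]
    rw [← Bundle.Trivialization.coe_symmₗ (R := ℝ) _ (FiberBundle.mem_baseSet_trivializationAt' x),
      map_zero]

theorem covariantDerivAlong_velocity_eq_zero_congr {γ σ : ℝ → M} {t : ℝ} (h : γ =ᶠ[𝓝 t] σ) :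
    covariantDerivAlong cov γ (velocity n γ) t = 0 ↔
      covariantDerivAlong cov σ (velocity n σ) t = 0 := by
  -- The two sides live in different tangent spaces, so the curve `c` of velocities and its value
  -- `p` at time `t` are replaced in turn.
  let e (x : M) := trivializationAt (EuclideanSpace ℝ (Fin n)) (TangentSpace (𝓡 n) : M → Type _) x
  let D (c : ℝ → TangentBundle (𝓡 n) M) (p : TangentBundle (𝓡 n) M) : TangentSpace (𝓡 n) p.1 :=
    (e p.1).symm p.1 (deriv (fun s => (e p.1 (c s)).2) t)
      + cov (FiberBundle.extend (EuclideanSpace ℝ (Fin n)) p.2) p.1 p.2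
  have hlift := eventuallyEq_velocity_lift (n := n) h
  have hD (p) : D (fun s => ⟨γ s, velocity n γ s⟩) p = D (fun s => ⟨σ s, velocity n σ s⟩) p := by
    have hcoord := hlift.fun_comp fun q => (e p.1 q).2
    exact congrArg (fun a => (e p.1).symm p.1 a + _) hcoord.deriv_eq
  have hpoint : (⟨γ t, velocity n γ t⟩ : TangentBundle (𝓡 n) M) = ⟨σ t, velocity n σ t⟩ :=
    hlift.eq_of_nhds
  change D _ ⟨γ t, velocity n γ t⟩ = 0 ↔ D _ ⟨σ t, velocity n σ t⟩ = 0
  rw [hD, hpoint]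

theorem exists_forall_eqOn {ι α β : Type*} [Nonempty ι] {g : ι → α → β} {s : ι → Set α}
    (h : ∀ i j, Set.EqOn (g i) (g j) (s i ∩ s j)) : ∃ g₀, ∀ i, Set.EqOn g₀ (g i) (s i) := by
  have hpoint (a : α) : ∃ b, ∀ i, a ∈ s i → b = g i a := by
    by_cases ha : ∃ i, a ∈ s i
    · obtain ⟨i, hi⟩ := ha
      exact ⟨g i a, fun j hj => h i j ⟨hi, hj⟩⟩
    · exact ⟨g (Classical.arbitrary ι) a, fun i hi => absurd ⟨i, hi⟩ ha⟩
  choose g₀ hg₀ using hpoint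
  exact ⟨g₀, fun i a ha => hg₀ a i ha⟩

theorem IsGeodesicOn.iUnion {ι : Type*} {γ : ι → ℝ → M} {I : ι → Set ℝ} {σ : ℝ → M}
    [Nonempty ι] (h : ∀ i, IsGeodesicOn cov (γ i) (I i)) (hI : (⋂ i, I i).Nonempty)
    (hσ : ∀ i, Set.EqOn σ (γ i) (I i)) : IsGeodesicOn cov σ (⋃ i, I i) := by
  have hgerm {i : ι} {t : ℝ} (ht : t ∈ I i) : σ =ᶠ[𝓝 t] γ i :=
    (hσ i).eventuallyEq_of_mem ((h i).isOpen.mem_nhds ht)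
  refine ⟨isOpen_iUnion fun i => (h i).isOpen, ?_, hI.mono Set.iInter_subset_iUnion, ?_, ?_⟩
  · obtain ⟨t, ht⟩ := hI
    exact (isPreconnected_iUnion ⟨t, ht⟩ fun i => (h i).ordConnected.isPreconnected).ordConnected
  · intro t ht
    obtain ⟨i, hi⟩ := Set.mem_iUnion.1 ht
    exact ((((h i).smooth t hi).contMDiffAt ((h i).isOpen.mem_nhds hi)).congr_of_eventuallyEq
      (hgerm hi)).contMDiffWithinAt
  · intro t ht
    obtain ⟨i, hi⟩ := Set.mem_iUnion.1 ht
    exact (covariantDerivAlong_velocity_eq_zero_congr (hgerm hi)).2 ((h i).geodesic t hi)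

/-- The geodesic `γ` on `I` is maximal: it does not extend to a geodesic on a larger interval. The
values of `γ` outside `I` play no role. -/
structure IsMaximalGeodesic (cov : CovariantDerivative (𝓡 n) (EuclideanSpace ℝ (Fin n))
    (TangentSpace (𝓡 n) : M → Type _)) (γ : ℝ → M) (I : Set ℝ) : Prop where
  isGeodesicOn : IsGeodesicOn cov γ I
  maximal : ∀ (σ : ℝ → M) (J : Set ℝ), IsGeodesicOn cov σ J → I ⊆ J → Set.EqOn σ γ I → J ⊆ I

theorem IsGeodesicOn.exists_isMaximalGeodesic {γ₀ : ℝ → M} {I₀ : Set ℝ}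
    (h₀ : IsGeodesicOn cov γ₀ I₀) :
    ∃ γ I, IsMaximalGeodesic cov γ I ∧ I₀ ⊆ I ∧ Set.EqOn γ γ₀ I₀ := by
  let S := {p : (ℝ → M) × Set ℝ // IsGeodesicOn cov p.1 p.2 ∧ I₀ ⊆ p.2 ∧ Set.EqOn p.1 γ₀ I₀}
  let IsExtension (p q : S) : Prop := p.1.2 ⊆ q.1.2 ∧ Set.EqOn q.1.1 p.1.1 p.1.2
  have : Nonempty S := ⟨⟨(γ₀, I₀), h₀, subset_rfl, fun _ _ => rfl⟩⟩
  have hchain (c : Set S) (hc : IsChain IsExtension c) (hne : c.Nonempty) :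
      ∃ ub, ∀ p ∈ c, IsExtension p ub := by
    have : Nonempty c := hne.to_subtype
    have hcompat (p q : c) : Set.EqOn p.1.1.1 q.1.1.1 (p.1.1.2 ∩ q.1.1.2) := by
      rintro t ⟨hp, hq⟩
      rcases eq_or_ne p.1 q.1 with hpq | hpq
      · rw [hpq]
      · rcases hc p.2 q.2 hpq with hle | hle
        exacts [(hle.2 hp).symm, hle.2 hq]
    obtain ⟨σ, hσ⟩ := exists_forall_eqOn hcompat
    have hσ_geo := IsGeodesicOn.iUnion (fun p : c => p.1.2.1)
      (h₀.nonempty.mono (Set.subset_iInter fun p => p.1.2.2.1)) hσ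
    obtain ⟨p₀⟩ := ‹Nonempty c›
    refine ⟨⟨(σ, ⋃ p : c, p.1.1.2), hσ_geo, ?_, ?_⟩, fun p hp => ⟨?_, hσ ⟨p, hp⟩⟩⟩
    · exact p₀.1.2.2.1.trans (Set.subset_iUnion (fun p : c => p.1.1.2) p₀)
    · exact ((hσ p₀).mono p₀.1.2.2.1).trans p₀.1.2.2.2
    · exact Set.subset_iUnion (fun p : c => p.1.1.2) ⟨p, hp⟩
  obtain ⟨m, hm⟩ := exists_maximal_of_nonempty_chains_bounded hchain
    fun hab hbc => ⟨hab.1.trans hbc.1, (hbc.2.mono hab.1).trans hab.2⟩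
  exact ⟨m.1.1, m.1.2, ⟨m.2.1, fun σ J hσ hJ heq =>
    (hm ⟨(σ, J), hσ, m.2.2.1.trans hJ, (heq.mono m.2.2.1).trans m.2.2.2⟩ ⟨hJ, heq⟩).1⟩, m.2.2⟩

theorem isCompleteConnection_of_forall_isMaximalGeodesic
    (h : ∀ γ I, IsMaximalGeodesic cov γ I → I = Set.univ) : IsCompleteConnection cov := by
  intro γ₀ I₀ h₀
  obtain ⟨γ, I, hγ, -, heq⟩ := h₀.exists_isMaximalGeodesic
  obtain rfl := h γ I hγ
  exact ⟨γ, hγ.isGeodesicOn, heq⟩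

end Geodesics

section GaussFormula

open Filter Topology

variable {n : ℕ} {M : Type*} [TopologicalSpace M] [ChartedSpace (EuclideanSpace ℝ (Fin n)) M]
  {V : Type*} [NormedAddCommGroup V] [NormedSpace ℝ V] {F : M → V} {γ : ℝ → M} {t : ℝ} {p : M}

theorem hasDerivAt_comp_curve (hF : MDifferentiableAt (𝓡 n) 𝓘(ℝ, V) F (γ t))
    (hγ : MDifferentiableAt 𝓘(ℝ, ℝ) (𝓡 n) γ t) :
    HasDerivAt (fun s => F (γ s)) (mvfderiv (𝓡 n) F (γ t) (velocity n γ t)) t := by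
  have hcomp := (hF.comp t hγ).hasMFDerivAt
  rw [mfderiv_comp t hF hγ] at hcomp
  let L : ℝ →L[ℝ] V := (mvfderiv (𝓡 n) F (γ t)).comp (mfderiv 𝓘(ℝ, ℝ) (𝓡 n) γ t)
  have hderiv : HasFDerivAt (fun s => F (γ s)) L t := hcomp.hasFDerivAt
  exact hderiv.hasDerivAt

theorem mvfderiv_clm_apply_const {W : Type*} [NormedAddCommGroup W] [NormedSpace ℝ W]
    {L : M → W →L[ℝ] V} (hL : MDifferentiableAt (𝓡 n) 𝓘(ℝ, W →L[ℝ] V) L p) (a : W)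
    (w : TangentSpace (𝓡 n) p) :
    mvfderiv (𝓡 n) (fun y => L y a) p w = mvfderiv (𝓡 n) L p w a := by
  have hcomp := (ContinuousLinearMap.apply ℝ V a).hasMFDerivAt.comp p hL.hasMFDerivAt
  exact DFunLike.congr_fun hcomp.mfderiv w

variable [IsManifold (𝓡 n) ∞ M]

/-- The trivialization of the tangent bundle in which `covariantDerivAlong` and
`FiberBundle.extend` express vector fields near `p`. -/
abbrev tangentTrivialization (n : ℕ) {M : Type*} [TopologicalSpace M]
    [ChartedSpace (EuclideanSpace ℝ (Fin n)) M] [IsManifold (𝓡 n) ∞ M] (p : M) :=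
  trivializationAt (EuclideanSpace ℝ (Fin n)) (TangentSpace (𝓡 n) : M → Type _) p

theorem tangentTrivialization_baseSet_mem_nhds (n : ℕ) {M : Type*} [TopologicalSpace M]
    [ChartedSpace (EuclideanSpace ℝ (Fin n)) M] [IsManifold (𝓡 n) ∞ M] (p : M) :
    (tangentTrivialization n p).baseSet ∈ 𝓝 p :=
  (tangentTrivialization n p).open_baseSet.mem_nhds (FiberBundle.mem_baseSet_trivializationAt' p)

/-- The differential of `F` at `y`, expressed in the trivialization of the tangent bundle
around `p`. -/
def localDifferential (F : M → V) (p y : M) : EuclideanSpace ℝ (Fin n) →L[ℝ] V :=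
  (mvfderiv (𝓡 n) F y).comp ((tangentTrivialization n p).symmL ℝ y)

theorem localDifferential_apply {y : M} (hy : y ∈ (tangentTrivialization n p).baseSet)
    (a : EuclideanSpace ℝ (Fin n)) :
    localDifferential F p y a = mvfderiv (𝓡 n) F y ((tangentTrivialization n p).symm y a) := by
  rw [localDifferential, ContinuousLinearMap.comp_apply, Bundle.Trivialization.symmL_apply _ hy]

theorem mvfderiv_apply_eq_localDifferential {y : M}
    (hy : y ∈ (tangentTrivialization n p).baseSet) (v : TangentSpace (𝓡 n) y) :
    mvfderiv (𝓡 n) F y v = localDifferential F p y (tangentTrivialization n p ⟨y, v⟩).2 := by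
  rw [localDifferential_apply hy, (tangentTrivialization n p).symm_apply_apply_mk hy]

theorem mdifferentiableAt_localDifferential (hF : ContMDiffAt (𝓡 n) 𝓘(ℝ, V) 2 F p) :
    MDifferentiableAt (𝓡 n) 𝓘(ℝ, EuclideanSpace ℝ (Fin n) →L[ℝ] V)
      (localDifferential (n := n) F p) p := by
  have hcoord := (hF.mfderiv_const (m := 1) (by norm_num)).mdifferentiableAt one_ne_zero
  refine hcoord.congr_of_eventuallyEq (Eventually.of_forall fun y => ?_)
  ext1 a
  simp only [inTangentCoordinates, ContinuousLinearMap.inCoordinates, localDifferential,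
    ContinuousLinearMap.comp_apply]
  rw [TangentBundle.continuousLinearMapAt_model_space]
  rfl

theorem mvfderiv_pushforward_extend (hF : ContMDiffAt (𝓡 n) 𝓘(ℝ, V) 2 F p)
    (v w : TangentSpace (𝓡 n) p) :
    mvfderiv (𝓡 n)
        (fun y => mvfderiv (𝓡 n) F y (FiberBundle.extend (EuclideanSpace ℝ (Fin n)) v y)) p w
      = mvfderiv (𝓡 n) (localDifferential (n := n) F p) p w
          (tangentTrivialization n p ⟨p, v⟩).2 := by
  rw [← mvfderiv_clm_apply_const (mdifferentiableAt_localDifferential hF)]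
  have hext : (fun y => mvfderiv (𝓡 n) F y (FiberBundle.extend (EuclideanSpace ℝ (Fin n)) v y))
      =ᶠ[𝓝 p] fun y => localDifferential F p y (tangentTrivialization n p ⟨p, v⟩).2 := by
    filter_upwards [tangentTrivialization_baseSet_mem_nhds n p] with y hy
    exact (localDifferential_apply hy _).symm
  exact DFunLike.congr_fun hext.mfderiv_eq w

theorem differentiableAt_velocity_coord (hγ : ContMDiffAt 𝓘(ℝ, ℝ) (𝓡 n) 2 γ t) :
    DifferentiableAt ℝ (fun s => (tangentTrivialization n (γ t) ⟨γ s, velocity n γ s⟩).2) t := by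
  have hcoord := (hγ.mfderiv_const (m := 1) (by norm_num)).mdifferentiableAt one_ne_zero
  refine (hcoord.differentiableAt.clm_apply (differentiableAt_const (1 : ℝ))).congr_of_eventuallyEq
    ?_
  filter_upwards [hγ.continuousAt (tangentTrivialization_baseSet_mem_nhds n (γ t))] with s hs
  simp only [inTangentCoordinates, ContinuousLinearMap.inCoordinates,
    ContinuousLinearMap.comp_apply]
  rw [TangentBundle.symmL_model_space, Bundle.Trivialization.continuousLinearMapAt_apply,
    Bundle.Trivialization.coe_linearMapAt_of_mem _ hs]
  rfl

theorem hasDerivAt_pushforward_along (hF : ContMDiffAt (𝓡 n) 𝓘(ℝ, V) 2 F (γ t))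
    (hγ : MDifferentiableAt 𝓘(ℝ, ℝ) (𝓡 n) γ t) {X : ∀ s, TangentSpace (𝓡 n) (γ s)}
    (hX : DifferentiableAt ℝ (fun s => (tangentTrivialization n (γ t) ⟨γ s, X s⟩).2) t) :
    HasDerivAt (fun s => mvfderiv (𝓡 n) F (γ s) (X s))
      (mvfderiv (𝓡 n) (fun y => mvfderiv (𝓡 n) F y
          (FiberBundle.extend (EuclideanSpace ℝ (Fin n)) (X t) y)) (γ t) (velocity n γ t)
        + mvfderiv (𝓡 n) F (γ t) ((tangentTrivialization n (γ t)).symm (γ t)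
          (deriv (fun s => (tangentTrivialization n (γ t) ⟨γ s, X s⟩).2) t))) t := by
  have hproduct := (hasDerivAt_comp_curve (mdifferentiableAt_localDifferential hF) hγ).clm_apply
    hX.hasDerivAt
  rw [mvfderiv_pushforward_extend hF,
    ← localDifferential_apply (FiberBundle.mem_baseSet_trivializationAt' (γ t))]
  refine hproduct.congr_of_eventuallyEq ?_
  filter_upwards [hγ.continuousAt (tangentTrivialization_baseSet_mem_nhds n (γ t))] with s hs
  exact mvfderiv_apply_eq_localDifferential hs (X s)

theorem gauss_formula_along {f ξ : M → EuclideanSpace ℝ (Fin (n + 1))}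
    (h : IsTransversalField f ξ) (hγ : MDifferentiableAt 𝓘(ℝ, ℝ) (𝓡 n) γ t)
    {X : ∀ s, TangentSpace (𝓡 n) (γ s)}
    (hX : DifferentiableAt ℝ (fun s => (tangentTrivialization n (γ t) ⟨γ s, X s⟩).2) t) :
    ∃ a : ℝ, HasDerivAt (fun s => mvfderiv (𝓡 n) f (γ s) (X s))
      (mvfderiv (𝓡 n) f (γ t) (covariantDerivAlong (inducedConnection h) γ X t)
        + a • ξ (γ t)) t := by
  obtain ⟨a, ha⟩ := gauss_formula h
    (FiberBundle.extend (EuclideanSpace ℝ (Fin n)) (X t)) (γ t) (velocity n γ t)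
  have hf : ContMDiffAt (𝓡 n) 𝓘(ℝ, EuclideanSpace ℝ (Fin (n + 1))) 2 f (γ t) :=
    (h.smooth_immersion (γ t)).of_le (by norm_cast)
  refine ⟨a, (hasDerivAt_pushforward_along hf hγ hX).congr_deriv ?_⟩
  rw [ha, covariantDerivAlong, map_add]
  abel

end GaussFormula

section PlaneForms

variable {E : Type*} [NormedAddCommGroup E] [InnerProductSpace ℝ E] [FiniteDimensional ℝ E]

theorem exists_clm_extending_alternatingMap {π : Submodule ℝ E} (d : π [⋀^Fin 2]→ₗ[ℝ] ℝ) :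
    ∃ Ω : E →L[ℝ] E →L[ℝ] ℝ, (∀ u, Ω u u = 0) ∧ ∀ u v : π, Ω u v = d ![u, v] := by
  let P := π.orthogonalProjectionOnto
  let B : E →ₗ[ℝ] E →ₗ[ℝ] ℝ := LinearMap.mk₂ ℝ (fun u v => d ![P u, P v])
    (fun u u' v => by simp only [map_add, d.map_vecCons_add])
    (fun c u v => by simp only [map_smul, d.map_vecCons_smul])
    (fun u v v' => by
      simpa only [map_add, d.curryLeft_apply_apply] using
        (d.curryLeft (P u)).map_vecCons_add ![] (P v) (P v'))
    (fun c u v => by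
      simpa only [map_smul, d.curryLeft_apply_apply] using
        (d.curryLeft (P u)).map_vecCons_smul ![] c (P v))
  refine ⟨(LinearMap.toContinuousLinearMap.toLinearMap ∘ₗ B).toContinuousLinearMap,
    fun u => ?_, fun u v => ?_⟩
  · exact d.map_eq_zero_of_eq ![P u, P u] (i := 0) (j := 1) rfl (by decide)
  · change d ![P u, P v] = _
    simp [P]

/-- `Ω` is an alternating bilinear form on the ambient space which restricts to an area form on the
plane `π`. -/
structure IsAreaForm {V : Type*} [NormedAddCommGroup V] [NormedSpace ℝ V] (Ω : V →L[ℝ] V →L[ℝ] ℝ)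
    (π : Submodule ℝ V) : Prop where
  self_eq_zero : ∀ u, Ω u u = 0
  ne_zero : ∀ u ∈ π, ∀ v ∈ π, LinearIndependent ℝ ![u, v] → Ω u v ≠ 0

theorem exists_isAreaForm {π : Submodule ℝ E} (hπ : Module.finrank ℝ π = 2) :
    ∃ Ω, IsAreaForm Ω π := by
  let b := Module.finBasisOfFinrankEq ℝ π hπ
  obtain ⟨Ω, hΩ_self, hΩ_det⟩ := exists_clm_extending_alternatingMap b.det
  refine ⟨Ω, hΩ_self, fun u hu v hv huv => ?_⟩
  lift u to π using hu
  lift v to π using hv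
  have hli : LinearIndependent ℝ ![u, v] := by
    refine LinearIndependent.of_comp π.subtype ?_
    convert huv using 1
    ext i : 1
    fin_cases i <;> rfl
  rw [hΩ_det]
  have hspan := hli.span_eq_top_of_card_eq_finrank' (by simp [hπ])
  exact (b.is_basis_iff_det.1 ⟨hli, hspan⟩).ne_zero

end PlaneForms

section CentralMotion

open Filter Topology

variable {V W : Type*} [NormedAddCommGroup V] [NormedSpace ℝ V] [NormedAddCommGroup W]
  [NormedSpace ℝ W] {r : ℝ → V} {I : Set ℝ} {t u : ℝ}

theorem deriv_mem_of_mem {π : Submodule ℝ V} (hπ : IsClosed (π : Set V)) (hI : IsOpen I)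
    (hr : ∀ t ∈ I, r t ∈ π) (ht : t ∈ I) : deriv r t ∈ π := by
  have hmem := range_derivWithin_subset_closure_span_image r (s := I) (t := I)
    (by rw [Set.inter_self]; exact subset_closure) (Set.mem_range_self t)
  rw [derivWithin_of_isOpen hI ht] at hmem
  exact closure_minimal (Submodule.span_le.2 (Set.image_subset_iff.2 hr)) hπ hmem

theorem hasDerivAt_apply_deriv (hI : IsOpen I) (hr : ContDiffOn ℝ ∞ r I) {B : V →L[ℝ] V →L[ℝ] W}
    (hB : ∀ v, B v v = 0) (ht : t ∈ I) :
    HasDerivAt (fun s => B (r s) (deriv r s)) (B (r t) (deriv (deriv r) t)) t := by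
  have hvel := hasDerivAt_of_contDiffOn hI hr ht
  have hacc := hasDerivAt_of_contDiffOn hI (contDiffOn_deriv hI hr) ht
  refine ((B.hasFDerivAt.comp_hasDerivAt t hvel).clm_apply hacc).congr_deriv ?_
  rw [hB, zero_add]
  rfl

/-- `r` describes on the open interval `I` the motion of a particle under a force directed towards
or away from the origin. -/
structure IsCentralMotionOn (r : ℝ → V) (I : Set ℝ) : Prop where
  isOpen : IsOpen I
  ordConnected : I.OrdConnected
  smooth : ContDiffOn ℝ ∞ r I
  central : ∀ t ∈ I, ∃ s : ℝ, deriv (deriv r) t = s • r t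

namespace IsCentralMotionOn

theorem area_eq (h : IsCentralMotionOn r I) {B : V →L[ℝ] V →L[ℝ] W} (hB : ∀ v, B v v = 0)
    (ht : t ∈ I) (hu : u ∈ I) : B (r t) (deriv r t) = B (r u) (deriv r u) := by
  refine eq_of_hasDerivAt_zero (g := fun s => B (r s) (deriv r s)) h.isOpen h.ordConnected
    (fun x hx => ?_) ht hu
  obtain ⟨s, hs⟩ := h.central x hx
  refine (hasDerivAt_apply_deriv h.isOpen h.smooth hB hx).congr_deriv ?_
  rw [hs, map_smul, hB, smul_zero]

theorem smul_deriv_sub_smul_eq (h : IsCentralMotionOn r I) (α : V →L[ℝ] ℝ) (ht : t ∈ I)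
    (hu : u ∈ I) :
    α (r t) • deriv r t - α (deriv r t) • r t = α (r u) • deriv r u - α (deriv r u) • r u := by
  let A : V →L[ℝ] V →L[ℝ] V := (ContinuousLinearMap.lsmul ℝ ℝ).comp α
  exact h.area_eq (B := A - A.flip) (fun v => sub_self (A v v)) ht hu

theorem linearIndependent (h : IsCentralMotionOn r I) (ht : t ∈ I) (hu : u ∈ I)
    (hli : LinearIndependent ℝ ![r t, deriv r t]) : LinearIndependent ℝ ![r u, deriv r u] := by
  obtain ⟨α, hα⟩ := SeparatingDual.exists_ne_zero (R := ℝ) (hli.ne_zero 0)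
  have hne : α (r u) • deriv r u - α (deriv r u) • r u ≠ 0 := fun h0 => by
    rw [← h.smul_deriv_sub_smul_eq α ht hu] at h0
    exact hα (LinearIndependent.pair_iff.1 hli (-α (deriv r t)) (α (r t))
      (by rw [← h0]; module)).2
  rw [LinearIndependent.pair_iff]
  intro a b hab
  have hαab : a * α (r u) + b * α (deriv r u) = 0 := by simpa using congrArg α hab
  have ha : a • (α (r u) • deriv r u - α (deriv r u) • r u) = 0 := by
    linear_combination (norm := module) (-α (deriv r u)) • hab + hαab • deriv r u
  have hb : b • (α (r u) • deriv r u - α (deriv r u) • r u) = 0 := by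
    linear_combination (norm := module) (α (r u)) • hab - hαab • r u
  exact ⟨(smul_eq_zero.1 ha).resolve_right hne, (smul_eq_zero.1 hb).resolve_right hne⟩

theorem mem_span [FiniteDimensional ℝ V] (h : IsCentralMotionOn r I) (ht : t ∈ I) (hu : u ∈ I)
    (hli : LinearIndependent ℝ ![r t, deriv r t]) :
    r u ∈ Submodule.span ℝ (Set.range ![r t, deriv r t]) := by
  by_contra hru
  obtain ⟨α, hαu, hα⟩ := Submodule.exists_le_ker_of_notMem hru
  have hαr : α (r t) = 0 := hα (Submodule.subset_span ⟨0, rfl⟩)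
  have hαr' : α (deriv r t) = 0 := hα (Submodule.subset_span ⟨1, rfl⟩)
  have hcons := h.smul_deriv_sub_smul_eq α.toContinuousLinearMap hu ht
  simp only [LinearMap.coe_toContinuousLinearMap', hαr, hαr', zero_smul, sub_zero] at hcons
  exact hαu (LinearIndependent.pair_iff.1 (h.linearIndependent ht hu hli) (-α (deriv r u))
    (α (r u)) (by rw [← hcons]; module)).2

theorem of_area_const {π : Submodule ℝ V} {Ω : V →L[ℝ] V →L[ℝ] ℝ} {C : ℝ}
    (hπ : IsClosed (π : Set V)) (hΩ : IsAreaForm Ω π) (hI : IsOpen I) (hI' : I.OrdConnected)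
    (hr : ContDiffOn ℝ ∞ r I) (hrπ : ∀ t ∈ I, r t ∈ π) (hr0 : ∀ t ∈ I, r t ≠ 0)
    (hC : ∀ t ∈ I, Ω (r t) (deriv r t) = C) : IsCentralMotionOn r I := by
  refine ⟨hI, hI', hr, fun t ht => ?_⟩
  have hacc_mem : deriv (deriv r) t ∈ π :=
    deriv_mem_of_mem hπ hI (fun u hu => deriv_mem_of_mem hπ hI hrπ hu) ht
  have harea : (fun s => Ω (r s) (deriv r s)) =ᶠ[𝓝 t] fun _ => C := by
    filter_upwards [hI.mem_nhds ht] with s hs using hC s hs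
  have hacc_area : Ω (r t) (deriv (deriv r) t) = 0 :=
    (hasDerivAt_apply_deriv hI hr hΩ.self_eq_zero ht).unique
      ((hasDerivAt_const t C).congr_of_eventuallyEq harea)
  have hdep := mt (hΩ.ne_zero _ (hrπ t ht) _ hacc_mem) (not_not.2 hacc_area)
  rw [LinearIndependent.pair_iff' (hr0 t ht)] at hdep
  push Not at hdep
  obtain ⟨s, hs⟩ := hdep
  exact ⟨s, hs.symm⟩

end IsCentralMotionOn

end CentralMotion

section ConstantCurves

open Filter Topology

variable {n : ℕ} {M : Type*} [TopologicalSpace M] [ChartedSpace (EuclideanSpace ℝ (Fin n)) M]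
  [IsManifold (𝓡 n) ∞ M] {γ : ℝ → M} {I : Set ℝ} {t u : ℝ}

theorem eventually_eq_of_velocity_eq_zero
    (h : ∀ᶠ s in 𝓝 t, MDifferentiableAt 𝓘(ℝ, ℝ) (𝓡 n) γ s ∧ velocity n γ s = 0) :
    ∀ᶠ s in 𝓝 t, γ s = γ t := by
  let c := extChartAt (𝓡 n) (γ t)
  have hsource : ∀ᶠ s in 𝓝 t, γ s ∈ c.source :=
    h.self_of_nhds.1.continuousAt (extChartAt_source_mem_nhds (γ t))
  obtain ⟨ε, hε, hball⟩ := Metric.eventually_nhds_iff_ball.1 (h.and hsource)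
  have hderiv : ∀ s ∈ Metric.ball t ε, HasDerivAt (fun s => c (γ s)) 0 s := fun s hs => by
    obtain ⟨⟨hdiff, hvel⟩, hs_source⟩ := hball s hs
    rw [← map_zero (mvfderiv (𝓡 n) c (γ s)), ← hvel]
    exact hasDerivAt_comp_curve
      (mdifferentiableAt_extChartAt (by simpa [c] using hs_source)) hdiff
  filter_upwards [Metric.ball_mem_nhds t hε] with s hs
  refine c.injOn (hball s hs).2 (mem_extChartAt_source (γ t)) ?_
  exact eq_of_hasDerivAt_zero Metric.isOpen_ball (convex_ball t ε).ordConnected hderiv hs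
    (Metric.mem_ball_self hε)

theorem eq_of_velocity_eq_zero (hI : IsOpen I) (hI' : I.OrdConnected)
    (hγ : ∀ s ∈ I, MDifferentiableAt 𝓘(ℝ, ℝ) (𝓡 n) γ s) (h0 : ∀ s ∈ I, velocity n γ s = 0)
    (ht : t ∈ I) (hu : u ∈ I) : γ t = γ u := by
  refine hI'.isPreconnected.induction₂ (fun x y => γ x = γ y) (fun x hx => ?_)
    (fun _ _ _ _ _ _ => Eq.trans) (fun _ _ _ _ => Eq.symm) ht hu
  have hnhds : ∀ᶠ s in 𝓝 x, MDifferentiableAt 𝓘(ℝ, ℝ) (𝓡 n) γ s ∧ velocity n γ s = 0 := by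
    filter_upwards [hI.mem_nhds hx] with s hs using ⟨hγ s hs, h0 s hs⟩
  exact ((eventually_eq_of_velocity_eq_zero hnhds).mono fun _ => Eq.symm).filter_mono
    nhdsWithin_le_nhds

theorem IsMaximalGeodesic.eq_univ_of_velocity_eq_zero
    {cov : CovariantDerivative (𝓡 n) (EuclideanSpace ℝ (Fin n)) (TangentSpace (𝓡 n) : M → Type _)}
    (hγ : IsMaximalGeodesic cov γ I) (h0 : ∀ s ∈ I, velocity n γ s = 0) : I = Set.univ := by
  obtain ⟨hI, hI', ⟨t, ht⟩, hsmooth, -⟩ := hγ.isGeodesicOn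
  have hdiff : ∀ s ∈ I, MDifferentiableAt 𝓘(ℝ, ℝ) (𝓡 n) γ s := fun s hs =>
    ((hsmooth s hs).contMDiffAt (hI.mem_nhds hs)).mdifferentiableAt (by simp)
  exact Set.univ_subset_iff.1 (hγ.maximal _ _ (isGeodesicOn_const (γ t)) (Set.subset_univ I)
    fun s hs => eq_of_velocity_eq_zero hI hI' hdiff h0 ht hs)

end ConstantCurves

section CentroaffineGeodesics

open Filter Topology

variable {n : ℕ} {M : Type*} [TopologicalSpace M] [ChartedSpace (EuclideanSpace ℝ (Fin n)) M]
  {f ξ : M → EuclideanSpace ℝ (Fin (n + 1))} {γ : ℝ → M} {I : Set ℝ} {t u : ℝ}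

theorem IsTransversalField.hasDerivAt_position (h : IsTransversalField f ξ) (hI : IsOpen I)
    (hγ : ContMDiffOn 𝓘(ℝ, ℝ) (𝓡 n) ∞ γ I) (ht : t ∈ I) :
    HasDerivAt (f ∘ γ) (mvfderiv (𝓡 n) f (γ t) (velocity n γ t)) t :=
  hasDerivAt_comp_curve ((h.smooth_immersion.mdifferentiable (by simp)) _)
    (((hγ t ht).contMDiffAt (hI.mem_nhds ht)).mdifferentiableAt (by simp))

theorem IsTransversalField.contDiffOn_position (h : IsTransversalField f ξ)
    (hγ : ContMDiffOn 𝓘(ℝ, ℝ) (𝓡 n) ∞ γ I) : ContDiffOn ℝ ∞ (f ∘ γ) I :=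
  (h.smooth_immersion.comp_contMDiffOn hγ).contDiffOn

namespace IsCentroaffineNormalization

theorem eq_zero_of_add_smul_eq_zero (h : IsCentroaffineNormalization f ξ) {x : M}
    {v : TangentSpace (𝓡 n) x} {s : ℝ} (hvs : mvfderiv (𝓡 n) f x v + s • f x = 0) :
    v = 0 ∧ s = 0 := by
  obtain ⟨hT, c, hc, hξ⟩ := h
  have hsplit : splitMap f ξ x (v, s * c⁻¹) = 0 := by
    rw [← hvs]
    simp only [splitMap, LinearMap.coprod_apply, LinearMap.toSpanSingleton_apply, hξ, smul_smul,
      inv_mul_cancel_right₀ hc]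
    rfl
  have hzero := (injective_iff_map_eq_zero _).1 (splitMap_bijective hT x).1 _ hsplit
  rw [Prod.mk_eq_zero] at hzero
  exact ⟨hzero.1, by simpa [hc] using hzero.2⟩

theorem position_ne_zero (h : IsCentroaffineNormalization f ξ) (x : M) : f x ≠ 0 := fun h0 =>
  one_ne_zero (h.eq_zero_of_add_smul_eq_zero (x := x) (v := 0) (s := 1) (by simp [h0])).2

theorem linearIndependent_position_deriv_iff (h : IsCentroaffineNormalization f ξ) (hI : IsOpen I)
    (hγ : ContMDiffOn 𝓘(ℝ, ℝ) (𝓡 n) ∞ γ I) (ht : t ∈ I) :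
    LinearIndependent ℝ ![(f ∘ γ) t, deriv (f ∘ γ) t] ↔ velocity n γ t ≠ 0 := by
  rw [(h.1.hasDerivAt_position hI hγ ht).deriv]
  refine ⟨fun hli h0 => hli.ne_zero 1 (by simp [h0]), fun hv => ?_⟩
  rw [LinearIndependent.pair_iff]
  intro a b hab
  have hzero := h.eq_zero_of_add_smul_eq_zero (x := γ t) (v := b • velocity n γ t) (s := a)
    (by rw [map_smul]; exact (add_comm _ _).trans hab)
  exact ⟨hzero.2, (smul_eq_zero.1 hzero.1).resolve_right hv⟩

variable [IsManifold (𝓡 n) ∞ M]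

theorem covariantDerivAlong_velocity_eq_zero_iff (h : IsCentroaffineNormalization f ξ)
    (hI : IsOpen I) (hγ : ContMDiffOn 𝓘(ℝ, ℝ) (𝓡 n) ∞ γ I) (ht : t ∈ I) :
    covariantDerivAlong (inducedConnection h.1) γ (velocity n γ) t = 0 ↔
      ∃ s : ℝ, deriv (deriv (f ∘ γ)) t = s • f (γ t) := by
  have hγt := (hγ t ht).contMDiffAt (hI.mem_nhds ht)
  obtain ⟨a, ha⟩ := gauss_formula_along h.1 (hγt.mdifferentiableAt (by simp))
    (differentiableAt_velocity_coord (hγt.of_le (by norm_cast)))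
  obtain ⟨c, -, hξ⟩ := h.2
  have hvel : deriv (f ∘ γ) =ᶠ[𝓝 t] fun s => mvfderiv (𝓡 n) f (γ s) (velocity n γ s) := by
    filter_upwards [hI.mem_nhds ht] with s hs using (h.1.hasDerivAt_position hI hγ hs).deriv
  rw [(ha.congr_of_eventuallyEq hvel).deriv, hξ]
  constructor
  · intro h0
    exact ⟨a * c, by rw [h0, map_zero, zero_add, smul_smul]⟩
  · rintro ⟨s, hs⟩
    refine (h.eq_zero_of_add_smul_eq_zero (s := a * c - s) ?_).1
    rw [sub_smul, ← hs, mul_smul]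
    abel

theorem isGeodesicOn_iff (h : IsCentroaffineNormalization f ξ) :
    IsGeodesicOn (inducedConnection h.1) γ I ↔
      I.Nonempty ∧ ContMDiffOn 𝓘(ℝ, ℝ) (𝓡 n) ∞ γ I ∧ IsCentralMotionOn (f ∘ γ) I := by
  constructor
  · rintro ⟨hI, hI', hne, hγ, hgeo⟩
    exact ⟨hne, hγ, hI, hI', h.1.contDiffOn_position hγ, fun t ht =>
      (h.covariantDerivAlong_velocity_eq_zero_iff hI hγ ht).1 (hgeo t ht)⟩
  · rintro ⟨hne, hγ, hI, hI', -, hcentral⟩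
    exact ⟨hI, hI', hne, hγ, fun t ht =>
      (h.covariantDerivAlong_velocity_eq_zero_iff hI hγ ht).2 (hcentral t ht)⟩

theorem isCentralMotionOn (h : IsCentroaffineNormalization f ξ)
    (hγ : IsGeodesicOn (inducedConnection h.1) γ I) : IsCentralMotionOn (f ∘ γ) I :=
  (h.isGeodesicOn_iff.1 hγ).2.2

theorem velocity_ne_zero (h : IsCentroaffineNormalization f ξ)
    (hγ : IsGeodesicOn (inducedConnection h.1) γ I) (ht : t ∈ I) (hu : u ∈ I)
    (hv : velocity n γ t ≠ 0) : velocity n γ u ≠ 0 :=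
  (h.linearIndependent_position_deriv_iff hγ.isOpen hγ.smooth hu).1
    ((h.isCentralMotionOn hγ).linearIndependent ht hu
      ((h.linearIndependent_position_deriv_iff hγ.isOpen hγ.smooth ht).2 hv))

theorem exists_isCurveInPlane (h : IsCentroaffineNormalization f ξ)
    (hγ : IsGeodesicOn (inducedConnection h.1) γ I) (ht : t ∈ I) (hv : velocity n γ t ≠ 0) :
    ∃ π : Submodule ℝ (EuclideanSpace ℝ (Fin (n + 1))), Module.finrank ℝ π = 2 ∧
      IsCurveInPlane f π γ I := by
  have hli := (h.linearIndependent_position_deriv_iff hγ.isOpen hγ.smooth ht).2 hv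
  exact ⟨_, by simpa using finrank_span_eq_card hli, hγ.isOpen, hγ.ordConnected, hγ.nonempty,
    hγ.smooth, fun u hu => h.velocity_ne_zero hγ ht hu hv,
    fun u hu => (h.isCentralMotionOn hγ).mem_span ht hu hli⟩

end IsCentroaffineNormalization

end CentroaffineGeodesics

section ParameterChange

open Filter Topology

variable {φ w : ℝ → ℝ} {I J : Set ℝ}

theorem exists_primitive (hJ : IsOpen J) (hJ' : J.OrdConnected) (hw : ContinuousOn w J) {u₀ : ℝ}
    (hu₀ : u₀ ∈ J) (t₀ : ℝ) : ∃ ψ : ℝ → ℝ, ψ u₀ = t₀ ∧ ∀ u ∈ J, HasDerivAt ψ (w u) u := by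
  refine ⟨fun u => t₀ + ∫ x in u₀..u, w x, by simp, fun u hu => ?_⟩
  refine (intervalIntegral.integral_hasDerivAt_right ?_ ?_
    (hw.continuousAt (hJ.mem_nhds hu))).const_add t₀
  · exact (hw.mono (hJ'.uIcc_subset hu₀ hu)).intervalIntegrable
  · exact hw.stronglyMeasurableAtFilter hJ u hu

theorem exists_isParameterChange_of_deriv_eq (hJ : IsOpen J) (hJ' : J.OrdConnected)
    (hw : ContDiffOn ℝ ∞ w J) (hw0 : ∀ u ∈ J, w u ≠ 0) {u₀ : ℝ} (hu₀ : u₀ ∈ J) (t₀ : ℝ) :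
    ∃ ψ : ℝ → ℝ, ψ u₀ = t₀ ∧ (∀ u ∈ J, deriv ψ u = w u) ∧ IsParameterChange ψ J (ψ '' J) := by
  obtain ⟨ψ, hψ₀, hψ⟩ := exists_primitive hJ hJ' hw.continuousOn hu₀ t₀
  have hderiv : ∀ u ∈ J, deriv ψ u = w u := fun u hu => (hψ u hu).deriv
  refine ⟨ψ, hψ₀, hderiv, ?_, fun u hu => (hderiv u hu).trans_ne (hw0 u hu), rfl⟩
  rw [contDiffOn_infty_iff_deriv_of_isOpen hJ]
  exact ⟨fun u hu => (hψ u hu).differentiableAt.differentiableWithinAt, hw.congr hderiv⟩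

namespace IsParameterChange

theorem mapsTo (h : IsParameterChange φ I J) : Set.MapsTo φ I J :=
  Set.mapsTo_iff_image_subset.2 h.image_eq.subset

theorem hasDerivAt (h : IsParameterChange φ I J) (hI : IsOpen I) {t : ℝ} (ht : t ∈ I) :
    HasDerivAt φ (deriv φ t) t :=
  hasDerivAt_of_contDiffOn hI h.smooth ht

theorem ordConnected (h : IsParameterChange φ I J) (hI' : I.OrdConnected) : J.OrdConnected :=
  h.image_eq ▸ (hI'.isPreconnected.image φ h.smooth.continuousOn).ordConnected

theorem injOn (h : IsParameterChange φ I J) (hI' : I.OrdConnected) : Set.InjOn φ I := by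
  have hne {a b : ℝ} (ha : a ∈ I) (hb : b ∈ I) (hab : a < b) : φ a ≠ φ b := fun heq => by
    have hsub : Set.Icc a b ⊆ I := hI'.out ha hb
    obtain ⟨c, hc, hc0⟩ := exists_deriv_eq_zero hab (h.smooth.continuousOn.mono hsub) heq
    exact h.deriv_ne_zero c (hsub (Set.Ioo_subset_Icc_self hc)) hc0
  intro a ha b hb heq
  by_contra hab
  rcases lt_or_gt_of_ne hab with hlt | hgt
  exacts [hne ha hb hlt heq, hne hb ha hgt heq.symm]

theorem isOpenMap_domRestrict (h : IsParameterChange φ I J) (hI : IsOpen I) :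
    IsOpenMap (I.domRestrict φ) := by
  rw [isOpenMap_iff_nhds_le]
  rintro ⟨t, ht⟩
  have hstrict : HasStrictDerivAt φ (deriv φ t) t :=
    (h.smooth.contDiffAt (hI.mem_nhds ht)).hasStrictDerivAt' (h.hasDerivAt hI ht) (by simp)
  have hmap : map (I.domRestrict φ) (𝓝 ⟨t, ht⟩) = 𝓝 (φ t) := by
    rw [Set.domRestrict_eq, ← Filter.map_map, map_nhds_subtype_coe_eq_nhds ht (hI.mem_nhds ht),
      hstrict.map_nhds_eq (h.deriv_ne_zero t ht)]
  exact hmap.ge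

theorem exists_inverse (h : IsParameterChange φ I J) (hI : IsOpen I) (hI' : I.OrdConnected) :
    IsOpen J ∧ ∃ τ, IsParameterChange τ J I ∧ Set.InvOn τ φ I J := by
  let e : OpenPartialHomeomorph ℝ ℝ :=
    .ofContinuousOpenRestrict ((h.injOn hI').toPartialEquiv φ I) h.smooth.continuousOn
      (h.isOpenMap_domRestrict hI) hI
  have he_target : e.target = J := h.image_eq
  have hinv : Set.InvOn e.symm φ I J := he_target ▸ e.invOn
  have hmaps : Set.MapsTo e.symm J I := he_target ▸ e.mapsTo_symm
  have hderiv {t : ℝ} (ht : t ∈ J) : HasDerivAt φ (deriv φ (e.symm t)) (e.symm t) :=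
    h.hasDerivAt hI (hmaps ht)
  refine ⟨he_target ▸ e.open_target, e.symm, ⟨fun t ht => ?_, fun t ht => ?_, ?_⟩, hinv⟩
  · exact (e.contDiffAt_symm_deriv (h.deriv_ne_zero _ (hmaps ht)) (he_target ▸ ht) (hderiv ht)
      (h.smooth.contDiffAt (hI.mem_nhds (hmaps ht)))).contDiffWithinAt
  · have hsymm := e.hasDerivAt_symm (he_target ▸ ht) (h.deriv_ne_zero _ (hmaps ht)) (hderiv ht)
    rw [hsymm.deriv]
    exact inv_ne_zero (h.deriv_ne_zero _ (hmaps ht))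
  · rw [← he_target]
    exact e.symm_image_target_eq_source

end IsParameterChange

end ParameterChange

section AreaParameter

open Filter Topology

variable {n : ℕ} {M : Type*} [TopologicalSpace M] [ChartedSpace (EuclideanSpace ℝ (Fin n)) M]
  {f ξ : M → EuclideanSpace ℝ (Fin (n + 1))}
  {π : Submodule ℝ (EuclideanSpace ℝ (Fin (n + 1)))}
  {Ω : EuclideanSpace ℝ (Fin (n + 1)) →L[ℝ] EuclideanSpace ℝ (Fin (n + 1)) →L[ℝ] ℝ}
  {σ : ℝ → M} {φ : ℝ → ℝ} {I J : Set ℝ} {t : ℝ}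

theorem velocity_comp (hσ : MDifferentiableAt 𝓘(ℝ, ℝ) (𝓡 n) σ (φ t))
    (hφ : DifferentiableAt ℝ φ t) :
    velocity n (σ ∘ φ) t = deriv φ t • velocity n σ (φ t) := by
  rw [velocity, mfderiv_comp t hσ hφ.mdifferentiableAt, mfderiv_eq_fderiv]
  have hsmul : fderiv ℝ φ t 1 = deriv φ t • (1 : ℝ) := by simp
  change mfderiv 𝓘(ℝ, ℝ) (𝓡 n) σ (φ t) (fderiv ℝ φ t 1) = _
  rw [hsmul]
  exact map_smul (mfderiv 𝓘(ℝ, ℝ) (𝓡 n) σ (φ t)) (deriv φ t) (1 : ℝ)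

theorem apply_deriv_comp {V : Type*} [NormedAddCommGroup V] [NormedSpace ℝ V] {r : ℝ → V}
    (B : V →L[ℝ] V →L[ℝ] ℝ) (hr : DifferentiableAt ℝ r (φ t)) (hφ : DifferentiableAt ℝ φ t) :
    B ((r ∘ φ) t) (deriv (r ∘ φ) t) = deriv φ t * B (r (φ t)) (deriv r (φ t)) := by
  rw [deriv.scomp t hr hφ, map_smul, smul_eq_mul]
  rfl

theorem IsCurveInPlane.comp_isParameterChange (hσ : IsCurveInPlane f π σ J)
    (hφ : IsParameterChange φ I J) (hI : IsOpen I) (hI' : I.OrdConnected) :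
    IsCurveInPlane f π (σ ∘ φ) I where
  isOpen := hI
  ordConnected := hI'
  nonempty := Set.image_nonempty.1 (hφ.image_eq ▸ hσ.nonempty)
  smooth := hσ.smooth.comp hφ.smooth.contMDiffOn hφ.mapsTo
  regular t ht := by
    have hσt := (hσ.smooth _ (hφ.mapsTo ht)).contMDiffAt (hσ.isOpen.mem_nhds (hφ.mapsTo ht))
    rw [velocity_comp (hσt.mdifferentiableAt (by simp)) (hφ.hasDerivAt hI ht).differentiableAt]
    exact smul_ne_zero (hφ.deriv_ne_zero t ht) (hσ.regular _ (hφ.mapsTo ht))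
  mem_plane t ht := hσ.mem_plane _ (hφ.mapsTo ht)

namespace IsCentroaffineNormalization

theorem area_ne_zero (h : IsCentroaffineNormalization f ξ) (hΩ : IsAreaForm Ω π)
    (hσ : IsCurveInPlane f π σ J) (ht : t ∈ J) : Ω ((f ∘ σ) t) (deriv (f ∘ σ) t) ≠ 0 :=
  hΩ.ne_zero _ (hσ.mem_plane t ht) _
    (deriv_mem_of_mem π.closed_of_finiteDimensional hσ.isOpen hσ.mem_plane ht)
    ((h.linearIndependent_position_deriv_iff hσ.isOpen hσ.smooth ht).2 (hσ.regular t ht))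

variable [IsManifold (𝓡 n) ∞ M]

theorem isGeodesicOn_of_area_const (h : IsCentroaffineNormalization f ξ) (hΩ : IsAreaForm Ω π)
    (hσ : IsCurveInPlane f π σ J) {C : ℝ}
    (hC : ∀ t ∈ J, Ω ((f ∘ σ) t) (deriv (f ∘ σ) t) = C) :
    IsGeodesicOn (inducedConnection h.1) σ J :=
  h.isGeodesicOn_iff.2 ⟨hσ.nonempty, hσ.smooth, .of_area_const π.closed_of_finiteDimensional hΩ
    hσ.isOpen hσ.ordConnected (h.1.contDiffOn_position hσ.smooth) hσ.mem_plane
    (fun t _ => h.position_ne_zero (σ t)) hC⟩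

theorem exists_geodesic_reparametrization (h : IsCentroaffineNormalization f ξ)
    (hΩ : IsAreaForm Ω π) (hσ : IsCurveInPlane f π σ J) {C : ℝ} (hC : C ≠ 0) {u₀ : ℝ}
    (hu₀ : u₀ ∈ J) (t₀ : ℝ) :
    ∃ (ψ τ : ℝ → ℝ) (T : Set ℝ), ψ u₀ = t₀ ∧ IsParameterChange ψ J T ∧
      (∀ u ∈ J, deriv ψ u = C⁻¹ * Ω ((f ∘ σ) u) (deriv (f ∘ σ) u)) ∧ Set.InvOn τ ψ J T ∧
      IsGeodesicOn (inducedConnection h.1) (σ ∘ τ) T := by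
  have hr := h.1.contDiffOn_position hσ.smooth
  obtain ⟨ψ, hψ₀, hψ', hψ⟩ := exists_isParameterChange_of_deriv_eq hσ.isOpen hσ.ordConnected
    (w := fun u => C⁻¹ * Ω ((f ∘ σ) u) (deriv (f ∘ σ) u))
    (contDiffOn_const.mul ((Ω.contDiff.comp_contDiffOn hr).clm_apply
      (contDiffOn_deriv hσ.isOpen hr)))
    (fun u hu => mul_ne_zero (inv_ne_zero hC) (h.area_ne_zero hΩ hσ hu)) hu₀ t₀
  obtain ⟨hT, τ, hτ, hinv⟩ := hψ.exists_inverse hσ.isOpen hσ.ordConnected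
  have hcurve := hσ.comp_isParameterChange hτ hT (hψ.ordConnected hσ.ordConnected)
  refine ⟨ψ, τ, ψ '' J, hψ₀, hψ, hψ', hinv, h.isGeodesicOn_of_area_const hΩ hcurve (C := C) ?_⟩
  rintro _ ⟨u, hu, rfl⟩
  have hgerm : f ∘ σ =ᶠ[𝓝 u] (f ∘ σ ∘ τ) ∘ ψ := by
    filter_upwards [hσ.isOpen.mem_nhds hu] with v hv
    simp only [Function.comp_apply, hinv.1 hv]
  have hr_diff := hasDerivAt_of_contDiffOn hT (h.1.contDiffOn_position hcurve.smooth)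
    (hψ.mapsTo hu)
  have harea := apply_deriv_comp Ω hr_diff.differentiableAt
    (hψ.hasDerivAt hσ.isOpen hu).differentiableAt
  rw [← hgerm.deriv_eq, ← hgerm.eq_of_nhds, hψ' u hu, mul_right_comm] at harea
  exact ((inv_mul_eq_one₀ hC).1 ((right_eq_mul₀ (h.area_ne_zero hΩ hσ hu)).1 harea)).symm

end IsCentroaffineNormalization

end AreaParameter

section MaximalGeodesics

open Filter Topology

variable {n : ℕ} {M : Type*} [TopologicalSpace M] [ChartedSpace (EuclideanSpace ℝ (Fin n)) M]
  [IsManifold (𝓡 n) ∞ M] {f ξ : M → EuclideanSpace ℝ (Fin (n + 1))}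
  {π : Submodule ℝ (EuclideanSpace ℝ (Fin (n + 1)))}
  {Ω : EuclideanSpace ℝ (Fin (n + 1)) →L[ℝ] EuclideanSpace ℝ (Fin (n + 1)) →L[ℝ] ℝ}
  {γ σ : ℝ → M} {φ ψ : ℝ → ℝ} {I J J' : Set ℝ} {t₀ : ℝ}

theorem differentiableAt_of_map_deriv_ne_zero {V : Type*} [NormedAddCommGroup V] [NormedSpace ℝ V]
    (d : V [⋀^Fin 2]→ₗ[ℝ] ℝ) {r : ℝ → V} {t : ℝ} (hd : d ![r t, deriv r t] ≠ 0) :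
    DifferentiableAt ℝ r t := by
  by_contra hr
  exact hd (d.map_coord_zero 1 (deriv_zero_of_not_differentiableAt hr))

namespace IsCentroaffineNormalization

theorem area_parameter_comp_eq_self (h : IsCentroaffineNormalization f ξ) (hΩ : IsAreaForm Ω π)
    (hγ : IsGeodesicOn (inducedConnection h.1) γ I) (hγπ : IsCurveInPlane f π γ I)
    (hσ : IsCurveInPlane f π σ J) (hJ' : J' ⊆ J) (hφ : IsParameterChange φ I J')
    (hγσ : ∀ t ∈ I, γ t = σ (φ t)) (ht₀ : t₀ ∈ I) (hψ : ∀ u ∈ J, HasDerivAt ψ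
      ((Ω ((f ∘ γ) t₀) (deriv (f ∘ γ) t₀))⁻¹ * Ω ((f ∘ σ) u) (deriv (f ∘ σ) u)) u)
    (hψ₀ : ψ (φ t₀) = t₀) : ∀ t ∈ I, ψ (φ t) = t := by
  suffices hconst : ∀ t ∈ I, ψ (φ t) - t = ψ (φ t₀) - t₀ by
    simpa [hψ₀, sub_eq_zero] using hconst
  refine fun t ht => eq_of_hasDerivAt_zero (g := fun s => ψ (φ s) - s) hγ.isOpen
    hγ.ordConnected (fun s hs => ?_) ht ht₀
  have hφs : φ s ∈ J := hJ' (hφ.mapsTo hs)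
  have hφ' := hφ.hasDerivAt hγ.isOpen hs
  have hgerm : f ∘ γ =ᶠ[𝓝 s] (f ∘ σ) ∘ φ := by
    filter_upwards [hγ.isOpen.mem_nhds hs] with v hv
    simp only [Function.comp_apply, hγσ v hv]
  have harea : Ω ((f ∘ γ) t₀) (deriv (f ∘ γ) t₀)
      = deriv φ s * Ω ((f ∘ σ) (φ s)) (deriv (f ∘ σ) (φ s)) := by
    rw [(h.isCentralMotionOn hγ).area_eq hΩ.self_eq_zero ht₀ hs, hgerm.deriv_eq, hgerm.eq_of_nhds]
    exact apply_deriv_comp Ω (hasDerivAt_of_contDiffOn hσ.isOpen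
      (h.1.contDiffOn_position hσ.smooth) hφs).differentiableAt hφ'.differentiableAt
  refine (((hψ _ hφs).comp s hφ').sub (hasDerivAt_id s)).congr_deriv ?_
  rw [mul_assoc, mul_comm _ (deriv φ s), ← harea,
    inv_mul_cancel₀ (h.area_ne_zero hΩ hγπ ht₀), sub_self]

theorem isMaximalCurveInPlane (h : IsCentroaffineNormalization f ξ)
    (hπ : Module.finrank ℝ π = 2) (hγ : IsMaximalGeodesic (inducedConnection h.1) γ I)
    (hγπ : IsCurveInPlane f π γ I) : IsMaximalCurveInPlane f π γ I := by
  refine ⟨hγπ, fun σ J J' φ hσ hJ' hφ hγσ => hJ'.antisymm ?_⟩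
  obtain ⟨Ω, hΩ⟩ := exists_isAreaForm hπ
  obtain ⟨t₀, ht₀⟩ := hγπ.nonempty
  obtain ⟨ψ, τ, T, hψ₀, hψ, hψ', hinv, hgeo⟩ := h.exists_geodesic_reparametrization hΩ hσ
    (h.area_ne_zero hΩ hγπ ht₀) (hJ' (hφ.mapsTo ht₀)) t₀
  have hψφ : ∀ t ∈ I, ψ (φ t) = t :=
    h.area_parameter_comp_eq_self hΩ hγ.isGeodesicOn hγπ hσ hJ' hφ hγσ ht₀
      (fun u hu => hψ' u hu ▸ hψ.hasDerivAt hσ.isOpen hu) hψ₀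
  have hIT : I ⊆ T := fun t ht => hψφ t ht ▸ hψ.mapsTo (hJ' (hφ.mapsTo ht))
  have hext : Set.EqOn (σ ∘ τ) γ I := fun t ht => by
    have hτ : τ t = φ t := by
      simpa only [hψφ t ht] using hinv.1 (hJ' (hφ.mapsTo ht))
    rw [Function.comp_apply, hτ, hγσ t ht]
  have hTI : T ⊆ I := hγ.maximal _ _ hgeo hIT hext
  intro u hu
  have hψu : ψ u ∈ I := hTI (hψ.mapsTo hu)
  have hφψ : φ (ψ u) = u :=
    hψ.injOn hσ.ordConnected (hJ' (hφ.mapsTo hψu)) hu (hψφ _ hψu)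
  exact hφψ ▸ hφ.mapsTo hψu

theorem eq_univ_of_hasGlobalParametrization (h : IsCentroaffineNormalization f ξ)
    (hγ : IsGeodesicOn (inducedConnection h.1) γ I) {d : π [⋀^Fin 2]→ₗ[ℝ] ℝ}
    (hd : HasGlobalParametrization f π d γ I) : I = Set.univ := by
  obtain ⟨φ, hφ, r, hr, c, hc, hbound⟩ := hd
  obtain ⟨Ω, hΩ₀, hΩ⟩ := exists_clm_extending_alternatingMap d
  obtain ⟨t₀, ht₀⟩ := hγ.nonempty
  set C := Ω ((f ∘ γ) t₀) (deriv (f ∘ γ) t₀)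
  have hφ_diff : Differentiable ℝ φ := fun t =>
    (hφ.hasDerivAt isOpen_univ (Set.mem_univ t)).differentiableAt
  have hdet (t : ℝ) : d ![r t, deriv r t] = deriv φ t * C := by
    have hφt : φ t ∈ I := hφ.mapsTo (Set.mem_univ t)
    have hrt : DifferentiableAt ℝ r t := differentiableAt_of_map_deriv_ne_zero d
      (abs_pos.1 (hc.trans_le (hbound t)))
    have hcoe : (f ∘ γ) ∘ φ = fun s => (r s : EuclideanSpace ℝ (Fin (n + 1))) :=
      funext fun s => (hr s).symm
    have hcoe' : deriv ((f ∘ γ) ∘ φ) t = deriv r t :=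
      hcoe ▸ (π.subtypeL.hasFDerivAt.comp_hasDerivAt t hrt.hasDerivAt).deriv
    rw [← hΩ, ← hcoe', hr]
    refine (apply_deriv_comp Ω (hasDerivAt_of_contDiffOn hγ.isOpen
      (h.1.contDiffOn_position hγ.smooth) hφt).differentiableAt (hφ_diff t)).trans ?_
    rw [(h.isCentralMotionOn hγ).area_eq hΩ₀ hφt ht₀]
  have hle (t : ℝ) : c ≤ |deriv φ t| * |C| := by
    rw [← abs_mul, ← hdet]
    exact hbound t
  have hC : 0 < |C| := pos_of_mul_pos_right (hc.trans_le (hle 0)) (abs_nonneg _)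
  have hsurj : Function.Surjective φ := surjective_of_le_abs_deriv hφ_diff (div_pos hc hC)
    fun t => (div_le_iff₀ hC).2 (hle t)
  rw [← hφ.image_eq, Set.image_univ, hsurj.range_eq]

end IsCentroaffineNormalization

end MaximalGeodesics

end AffineHypersurface

end

theorem theorem5p3_general {n : ℕ} {M : Type*} [TopologicalSpace M]
    [ChartedSpace (EuclideanSpace ℝ (Fin n)) M] [IsManifold (𝓡 n) ∞ M]
    (f ξ : M → EuclideanSpace ℝ (Fin (n + 1)))
    (hfξ : AffineHypersurface.IsCentroaffineNormalization f ξ)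
    (det : ∀ π : Submodule ℝ (EuclideanSpace ℝ (Fin (n + 1))), π [⋀^Fin 2]→ₗ[ℝ] ℝ)
    (hcurves : ∀ π : Submodule ℝ (EuclideanSpace ℝ (Fin (n + 1))), Module.finrank ℝ π = 2 →
      ∀ (γ : ℝ → M) (I : Set ℝ), AffineHypersurface.IsMaximalCurveInPlane f π γ I →
        AffineHypersurface.HasGlobalParametrization f π (det π) γ I) :
    AffineHypersurface.IsCompleteConnection (AffineHypersurface.inducedConnection hfξ.1) := by
  refine AffineHypersurface.isCompleteConnection_of_forall_isMaximalGeodesic fun γ I hγ => ?_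
  by_cases h0 : ∀ t ∈ I, AffineHypersurface.velocity n γ t = 0
  · exact hγ.eq_univ_of_velocity_eq_zero h0
  · push Not at h0
    obtain ⟨t, ht, hv⟩ := h0
    obtain ⟨π, hπ, hγπ⟩ := hfξ.exists_isCurveInPlane hγ.isGeodesicOn ht hv
    exact hfξ.eq_univ_of_hasGlobalParametrization hγ.isGeodesicOn
      (hcurves π hπ γ I (hfξ.isMaximalCurveInPlane hπ hγ hγπ))

theorem theorem5p3 {n : ℕ} {M : Type*} [TopologicalSpace M] [T2Space M]
    [ChartedSpace (EuclideanSpace ℝ (Fin n)) M] [IsManifold (𝓡 n) ∞ M]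
    (f ξ : M → EuclideanSpace ℝ (Fin (n + 1)))
    (hfξ : AffineHypersurface.IsCentroaffineNormalization f ξ)
    -- an arbitrarily chosen determinant on each plane through the origin
    (det : ∀ π : Submodule ℝ (EuclideanSpace ℝ (Fin (n + 1))), π [⋀^Fin 2]→ₗ[ℝ] ℝ)
    (hdet : ∀ π : Submodule ℝ (EuclideanSpace ℝ (Fin (n + 1))),
      Module.finrank ℝ π = 2 → det π ≠ 0)
    (hcurves : ∀ π : Submodule ℝ (EuclideanSpace ℝ (Fin (n + 1))), Module.finrank ℝ π = 2 →
      ∀ (γ : ℝ → M) (I : Set ℝ), AffineHypersurface.IsMaximalCurveInPlane f π γ I →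
        AffineHypersurface.HasGlobalParametrization f π (det π) γ I) :
    AffineHypersurface.IsCompleteConnection (AffineHypersurface.inducedConnection hfξ.1) :=
  theorem5p3_general f ξ hfξ det hcurves
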